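/- Let $K$ be an algebraically closed field of characteristic zero and let $C\subset\mathbb P^n_K$ be an irreducible curve, that is, an integral closed subscheme of $\mathbb P^n_K$ of dimension one. Assume that $C$ is non-degenerate (contained in no hyperplane), and that $C$ lies on two quadrics defined by linearly independent quadratic forms $g_1,g_2\in K[x_0,\dots,x_n]$. Then there exist a line $L\subset\mathbb P^n_K$ and a point $P$ such that: (i) $L$ is contained in no quadric of the pencil $\langle g_1,g_2\rangle$, i.e. for all $(a,b)\in K^2\setminus\{(0,0)\}$ the form $a g_1+b g_2$ does not vanish identically on $L$; (ii) $L\cap C=\{P\}$; (iii) $L$ and $C$ meet transversally at $P$, i.e. $C$ is smooth at $P$ and the tangent line of $C$ at $P$ is different from $L$. -/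

import Mathlib

open MvPolynomial
open scoped LinearAlgebra.Projectivization

attribute [local instance] MvPolynomial.gradedAlgebra

/-- Projective `n`-space over `K`, as the set of lines through the origin of `K ^ (n + 1)`. -/
abbrev ProjSpace (K : Type*) [Field K] (n : ℕ) : Type _ :=
  ℙ K (Fin (n + 1) → K)

/-- The set of points of `ℙⁿ` at which the form `F` vanishes. This does not depend on the
representatives if `F` is homogeneous. -/
def projZeros {K : Type*} [Field K] {n : ℕ} (F : MvPolynomial (Fin (n + 1)) K) :
    Set (ProjSpace K n) :=
  {P | eval P.rep F = 0}

/-- An integral (reduced and irreducible) closed subscheme of dimension one of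
`ℙⁿ = Proj K[x₀, …, xₙ]`, given by its saturated homogeneous ideal, which is prime.
The dimension is the topological dimension of the closed subset `V₊(I)` of `Proj K[x₀, …, xₙ]`;
that it is one implies that `I` does not contain the irrelevant ideal. -/
structure IrreducibleCurve (K : Type*) [Field K] (n : ℕ) where
  /-- the homogeneous ideal of all polynomials vanishing on the curve -/
  ideal : Ideal (MvPolynomial (Fin (n + 1)) K)
  isHomogeneous : ideal.IsHomogeneous (homogeneousSubmodule (Fin (n + 1)) K)
  isPrime : ideal.IsPrime
  dim_eq_one : topologicalKrullDim
    (ProjectiveSpectrum.zeroLocus (homogeneousSubmodule (Fin (n + 1)) K)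
      (ideal : Set (MvPolynomial (Fin (n + 1)) K))) = 1

namespace IrreducibleCurve

variable {K : Type*} [Field K] {n : ℕ}

/-- The set of (`K`-rational) points of the curve. -/
def points (C : IrreducibleCurve K n) : Set (ProjSpace K n) :=
  {P | ∀ F ∈ C.ideal, P ∈ projZeros F}

/-- The curve is a closed subscheme of the hypersurface defined by the form `F`. -/
def LiesOn (C : IrreducibleCurve K n) (F : MvPolynomial (Fin (n + 1)) K) : Prop :=
  F ∈ C.ideal

/-- The curve is contained in no hyperplane. -/
def Nondegenerate (C : IrreducibleCurve K n) : Prop :=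
  ∀ F : MvPolynomial (Fin (n + 1)) K, F.IsHomogeneous 1 → F ≠ 0 → ¬ C.LiesOn F

/-- The embedded projective tangent space to the curve at a point `P`, as a linear subspace of
`K ^ (n + 1)`: the common kernel of the differentials at `P` of the polynomials of the ideal.
(The projective tangent space is the projectivization of this subspace, so the Zariski tangent
space to the curve at `P` has one dimension less.) -/
def tangentSpace (C : IrreducibleCurve K n) (P : ProjSpace K n) :
    Submodule K (Fin (n + 1) → K) where
  carrier := {w | ∀ F ∈ C.ideal, ∑ i, w i * eval P.rep (pderiv i F) = 0}
  zero_mem' := by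
    intro F _
    simp
  add_mem' := by
    intro v w hv hw F hF
    simp [add_mul, Finset.sum_add_distrib, hv F hF, hw F hF]
  smul_mem' := by
    intro c w hw F hF
    simp [mul_assoc, ← Finset.mul_sum, hw F hF]

/-- `P` is a smooth point of the curve: the projective tangent space at `P` is a line. -/
def SmoothAt (C : IrreducibleCurve K n) (P : ProjSpace K n) : Prop :=
  P ∈ C.points ∧ Module.finrank K (C.tangentSpace P) = 2

end IrreducibleCurve

/-- A projective linear subspace is a line. -/
def IsProjLine {K : Type*} [Field K] {n : ℕ}
    (L : Projectivization.Subspace K (Fin (n + 1) → K)) : Prop :=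
  Module.finrank K (Projectivization.Subspace.submodule L) = 2

/-- The line `L` meets the curve `C` transversally at the point `P`: `P` lies on both, `C` is smooth
at `P`, and `L` is not tangent to `C` at `P`, that is, the projective tangent spaces at `P` of `C`
and of `L` (which is `L` itself) meet in the point `P` only. -/
def MeetsTransversallyAt {K : Type*} [Field K] {n : ℕ}
    (L : Projectivization.Subspace K (Fin (n + 1) → K)) (C : IrreducibleCurve K n)
    (P : ProjSpace K n) : Prop :=
  P ∈ L ∧ C.SmoothAt P ∧
    C.tangentSpace P ⊓ Projectivization.Subspace.submodule L = P.submodule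

/-! ### Krull dimension and algebraic independence -/

/-! The line joins a general point `P` of the curve, represented by `p`, to a general point `v` of
the ambient space. Each requirement on `v` is the non-vanishing of a nonzero polynomial, and `K` is
infinite, so all of them can be met at once.

For `L ∩ C = {P}`, `v` must avoid the cone over `C` with vertex `P`. That cone has dimension at most
two and so lies in a hypersurface, because `n ≥ 3` (`exists_cone_equation`). The bound on `n` holds
because the affine cone over `C` has dimension at least two and, as two independent quadrics contain
it, codimension at least two (`three_le_of_mem_quadrics`).

For transversality, `P` is taken smooth (`exists_forall_finrank_tangentSpace`) and `v` outside the
tangent space.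

For the pencil, a form `g` of degree two with `g(p) = 0` restricts to the line as `g(sp + tv) = t (s
dg_p(v) + t g(v))`. The two restrictions are therefore independent when `dg₁(v) g₂(v) - dg₂(v) g₁(v)
≠ 0`. This polynomial in `v` is not zero as long as the quadric of `g₁` is smooth at `P`
(`quadric_determinant_ne_zero`), one more open condition on `P`.

The topological dimension enters only through `exists_homogeneous_relation`: an affine chart of `C`
has dimension at most one, so three linear forms are always algebraically related on `C`. Both the
cone equation and generic smoothness rest on it. -/

/-- Lying over lifts the bottom prime of a chain, and going up lifts the rest. -/
theorem ringKrullDim_le_of_isIntegral {R S : Type*} [CommRing R] [CommRing S] [Algebra R S]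
    [Algebra.IsIntegral R S] (hinj : Function.Injective (algebraMap R S)) :
    ringKrullDim R ≤ ringKrullDim S := by
  refine iSup_le fun p => ?_
  obtain ⟨P, -, hP, hPc⟩ := Ideal.exists_ideal_over_prime_of_isIntegral (S := S)
    (RelSeries.head p).asIdeal ⊥ (by
      intro a ha
      have : a = 0 := hinj (by simpa using ha)
      simp [this])
  have : P.LiesOver (RelSeries.head p).asIdeal := ⟨hPc.symm⟩
  obtain ⟨q, hq, -⟩ := Ideal.exists_ltSeries_of_hasGoingUp p P
  rw [← hq]
  exact le_iSup (fun q : LTSeries (PrimeSpectrum S) => (q.length : WithBot ℕ∞)) q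

/-- By Noether normalization `B` is integral over a polynomial ring in `s` variables. These form a
transcendence basis, so `r ≤ s`, and `s` is at most the dimension of `B`. -/
theorem AlgebraicIndependent.le_ringKrullDim {K B : Type*} [Field K] [CommRing B] [IsDomain B]
    [Algebra K B] [Algebra.FiniteType K B] {r : ℕ} {x : Fin r → B}
    (hx : AlgebraicIndependent K x) : (r : WithBot ℕ∞) ≤ ringKrullDim B := by
  obtain ⟨s, g, hg, hint⟩ := exists_integral_inj_algHom_of_fg K B
  algebraize [g.toRingHom]
  have hdim := ringKrullDim_le_of_isIntegral (R := MvPolynomial (Fin s) K) (S := B) hg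
  rw [MvPolynomial.ringKrullDim_of_isNoetherianRing] at hdim
  have halg : AlgebraicIndependent K (fun i : Fin s => g (X i)) := by
    have h := (MvPolynomial.algebraicIndependent_X (Fin s) K).map' (f := g) hg
    exact h
  have hbasis : IsTranscendenceBasis K (fun i : Fin s => g (X i)) := by
    have := (faithfulSMul_iff_algebraMap_injective (MvPolynomial (Fin s) K) B).mpr hg
    have := IsTranscendenceBasis.algebraMap_comp (R := K) (A := B)
      (IsTranscendenceBasis.mvPolynomial (Fin s) K)
    exact this
  have hcard := hbasis.lift_cardinalMk_eq_trdeg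
  have hle := hx.lift_cardinalMk_le_trdeg
  rw [← hcard] at hle
  have hrs : r ≤ s := by simpa using hle
  refine le_trans ?_ hdim
  simpa using hrs

/-! ### Homogenization -/

section Homogenization

variable {K σ : Type*} [Field K]

/-- The homogenization of a polynomial with respect to a linear form `ℓ`. -/
noncomputable def homogenizeAlong (ℓ F : MvPolynomial σ K) : MvPolynomial σ K :=
  ∑ k ∈ Finset.range (F.totalDegree + 1),
    homogeneousComponent k F * ℓ ^ (F.totalDegree - k)

theorem isHomogeneous_homogenizeAlong {ℓ : MvPolynomial σ K} (hℓ : ℓ.IsHomogeneous 1)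
    (F : MvPolynomial σ K) : (homogenizeAlong ℓ F).IsHomogeneous F.totalDegree := by
  refine IsHomogeneous.sum _ _ _ fun k hk => ?_
  have h := (homogeneousComponent_isHomogeneous k F).mul (hℓ.pow (F.totalDegree - k))
  rwa [one_mul, Nat.add_sub_cancel' (by simpa [Nat.lt_succ_iff] using hk)] at h

theorem map_homogenizeAlong {B : Type*} [CommRing B] [Algebra K B] (ψ : MvPolynomial σ K →ₐ[K] B)
    {ℓ : MvPolynomial σ K} (hψ : ψ ℓ = 1) (F : MvPolynomial σ K) :
    ψ (homogenizeAlong ℓ F) = ψ F := by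
  conv_rhs => rw [← sum_homogeneousComponent F]
  simp [homogenizeAlong, hψ]

theorem MvPolynomial.IsHomogeneous.aeval_smul_point {B : Type*} [CommRing B] [Algebra K B]
    {F : MvPolynomial σ K} {d : ℕ} (hF : F.IsHomogeneous d) (c : B) (y : σ → B) :
    MvPolynomial.aeval (c • y) F = c ^ d * MvPolynomial.aeval y F := by
  simp only [MvPolynomial.aeval_def, MvPolynomial.eval₂_eq, Finset.mul_sum]
  refine Finset.sum_congr rfl fun m hm => ?_
  have hd : m.degree = d := by
    by_contra h
    exact (mem_support_iff.mp hm) (hF.coeff_eq_zero h)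
  simp only [Pi.smul_apply, smul_eq_mul, mul_pow, Finset.prod_mul_distrib,
    Finset.prod_pow_eq_pow_sum]
  rw [show ∑ i ∈ m.support, m i = d from hd]
  ring

theorem MvPolynomial.IsHomogeneous.eval_smul_point {F : MvPolynomial σ K} {d : ℕ}
    (hF : F.IsHomogeneous d) (c : K) (y : σ → K) :
    MvPolynomial.eval (c • y) F = c ^ d * MvPolynomial.eval y F := by
  simpa [aeval_eq_eval] using IsHomogeneous.aeval_smul_point hF c y

end Homogenization

/-! ### The affine charts of a closed subset of projective space -/

section Chart

variable {K σ B : Type*} [Field K] [CommRing B] [Algebra K B]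

/-- Think of `B` as the coordinate ring of a closed subset of the chart `ℓ ≠ 0`. A prime of `B` is
sent to the homogeneous core of its preimage. This map is inducing because homogenizing along `ℓ`
does not change the value of `ψ`, and an inducing map is enough to compare dimensions. -/
theorem ringKrullDim_le_topologicalKrullDim_zeroLocus (I : Ideal (MvPolynomial σ K))
    (hI : I.IsHomogeneous (homogeneousSubmodule σ K))
    (ψ : MvPolynomial σ K →ₐ[K] B) (hψ : Function.Surjective ψ)
    (hψI : ∀ F ∈ I, ψ F = 0) {ℓ : MvPolynomial σ K} (hℓ : ℓ.IsHomogeneous 1)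
    (hψℓ : ψ ℓ = 1) :
    ringKrullDim B ≤ topologicalKrullDim
      (ProjectiveSpectrum.zeroLocus (homogeneousSubmodule σ K) (I : Set (MvPolynomial σ K))) := by
  rw [← PrimeSpectrum.topologicalKrullDim_eq_ringKrullDim]
  let core (Q : PrimeSpectrum B) : HomogeneousIdeal (homogeneousSubmodule σ K) :=
    (Q.asIdeal.comap ψ).homogeneousCore (homogeneousSubmodule σ K)
  have hle (Q : PrimeSpectrum B) {F : MvPolynomial σ K} (hF : F ∈ core Q) : ψ F ∈ Q.asIdeal :=
    Ideal.toIdeal_homogeneousCore_le _ (Q.asIdeal.comap ψ) hF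
  have hmem (Q : PrimeSpectrum B) {F : MvPolynomial σ K} {d : ℕ} (hF : F.IsHomogeneous d)
      (h : ψ F ∈ Q.asIdeal) : F ∈ core Q :=
    Ideal.mem_homogeneousCore_of_homogeneous_of_mem (𝒜 := homogeneousSubmodule σ K)
      (I := Q.asIdeal.comap ψ) ⟨d, hF⟩ h
  have hprime (Q : PrimeSpectrum B) : (core Q).toIdeal.IsPrime :=
    Ideal.IsPrime.homogeneousCore (Q.isPrime.comap ψ)
  let f (Q : PrimeSpectrum B) : ProjectiveSpectrum.zeroLocus (homogeneousSubmodule σ K)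
      (I : Set (MvPolynomial σ K)) :=
    ⟨⟨core Q, hprime Q, fun h => by
      have hℓQ : ℓ ∈ core Q := h (HomogeneousIdeal.mem_irrelevant_of_mem _ zero_lt_one hℓ)
      have := hle Q hℓQ
      rw [hψℓ] at this
      exact Q.isPrime.ne_top ((Ideal.eq_top_iff_one _).mpr this)⟩, by
      intro F hF
      exact (mem_iff_homogeneousComponent_mem (core Q).isHomogeneous F).mpr fun d =>
        hmem Q (homogeneousComponent_isHomogeneous d F) (by
          simp [hψI _ (homogeneousComponent_mem_of_mem hI hF d)])⟩
  refine Topology.IsInducing.topologicalKrullDim_le (f := f) ⟨TopologicalSpace.ext_isClosed ?_⟩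
  intro Z
  rw [isClosed_induced_iff]
  constructor
  · intro hZ
    obtain ⟨s, rfl⟩ := (PrimeSpectrum.isClosed_iff_zeroLocus Z).mp hZ
    refine ⟨Subtype.val ⁻¹' ProjectiveSpectrum.zeroLocus _ (homogenizeAlong ℓ '' (ψ ⁻¹' s)),
      (ProjectiveSpectrum.isClosed_zeroLocus _ _).preimage continuous_subtype_val, ?_⟩
    ext Q
    simp only [Set.mem_preimage, ProjectiveSpectrum.mem_zeroLocus, PrimeSpectrum.mem_zeroLocus]
    constructor
    · intro h b hb
      obtain ⟨F, rfl⟩ := hψ b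
      have := hle Q (h ⟨F, hb, rfl⟩)
      rwa [map_homogenizeAlong ψ hψℓ] at this
    · rintro h _ ⟨F, hF, rfl⟩
      refine hmem Q (isHomogeneous_homogenizeAlong hℓ F) ?_
      rw [map_homogenizeAlong ψ hψℓ]
      exact h hF
  · rintro ⟨_, ht, rfl⟩
    obtain ⟨t, ht', rfl⟩ := isClosed_induced_iff.mp ht
    obtain ⟨s, rfl⟩ := (ProjectiveSpectrum.isClosed_iff_zeroLocus _ _).mp ht'
    rw [PrimeSpectrum.isClosed_iff_zeroLocus]
    refine ⟨{b | ∃ F ∈ s, ∃ d, b = ψ (homogeneousComponent d F)}, ?_⟩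
    ext Q
    simp only [Set.mem_preimage, ProjectiveSpectrum.mem_zeroLocus, PrimeSpectrum.mem_zeroLocus]
    constructor
    · rintro h _ ⟨F, hF, d, rfl⟩
      exact hle Q (homogeneousComponent_mem_of_mem (core Q).isHomogeneous (h hF) d)
    · intro h F hF
      exact (mem_iff_homogeneousComponent_mem (core Q).isHomogeneous F).mpr fun d =>
        hmem Q (homogeneousComponent_isHomogeneous d F) (h ⟨F, hF, d, rfl⟩)

end Chart

/-! ### The homogeneous coordinate ring -/

namespace IrreducibleCurve

variable {K : Type*} [Field K] {n : ℕ} (C : IrreducibleCurve K n)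

instance : C.ideal.IsPrime := C.isPrime

/-- The homogeneous coordinate ring of a curve. -/
abbrev CoordRing : Type _ := MvPolynomial (Fin (n + 1)) K ⧸ C.ideal

/-- The field of fractions of the homogeneous coordinate ring. -/
abbrev ConeField : Type _ := FractionRing C.CoordRing

/-- The generic point of the affine cone over a curve. -/
noncomputable def genericPoint (i : Fin (n + 1)) : C.ConeField :=
  algebraMap C.CoordRing C.ConeField (Ideal.Quotient.mk C.ideal (X i))

theorem aeval_genericPoint (F : MvPolynomial (Fin (n + 1)) K) :
    aeval C.genericPoint F = algebraMap C.CoordRing C.ConeField (Ideal.Quotient.mk C.ideal F) := by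
  have : aeval C.genericPoint = (IsScalarTower.toAlgHom K C.CoordRing C.ConeField).comp
      (Ideal.Quotient.mkₐ K C.ideal) := by
    ext i
    simp [genericPoint]
  rw [this]
  rfl

theorem aeval_genericPoint_eq_zero_iff (F : MvPolynomial (Fin (n + 1)) K) :
    aeval C.genericPoint F = 0 ↔ F ∈ C.ideal := by
  rw [aeval_genericPoint, FaithfulSMul.algebraMap_eq_zero_iff, Ideal.Quotient.eq_zero_iff_mem]

theorem aeval_genericPoint_aeval {σ : Type*} (ℓ : σ → MvPolynomial (Fin (n + 1)) K)
    (G : MvPolynomial σ K) :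
    aeval C.genericPoint (aeval ℓ G) = aeval (fun i => aeval C.genericPoint (ℓ i)) G := by
  rw [← AlgHom.comp_apply, comp_aeval]

/-- Any three linear forms satisfy a homogeneous algebraic relation on a curve. -/
theorem exists_homogeneous_relation (ℓ : Fin 3 → MvPolynomial (Fin (n + 1)) K)
    (hℓ : ∀ i, (ℓ i).IsHomogeneous 1) (hℓC : ℓ 2 ∉ C.ideal) :
    ∃ (d : ℕ) (G : MvPolynomial (Fin 3) K), G ≠ 0 ∧ G.IsHomogeneous d ∧ aeval ℓ G ∈ C.ideal := by
  -- The generic point is rescaled so that `ℓ 2` takes the value one. The range of evaluation there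
  -- is the ring of the chart `ℓ 2 ≠ 0`, to which the dimension bound applies.
  set c : C.ConeField := aeval C.genericPoint (ℓ 2) with hc
  have hc0 : c ≠ 0 := fun h => hℓC ((C.aeval_genericPoint_eq_zero_iff _).mp h)
  set y : Fin (n + 1) → C.ConeField := c⁻¹ • C.genericPoint with hy
  set ψ : MvPolynomial (Fin (n + 1)) K →ₐ[K] (aeval (R := K) y).range :=
    (aeval (R := K) y).rangeRestrict with hψ
  have hψs : Function.Surjective ψ := AlgHom.rangeRestrict_surjective _
  have hψc (F : MvPolynomial (Fin (n + 1)) K) (hF : F.IsHomogeneous 1) :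
      (ψ F : C.ConeField) = c⁻¹ * aeval C.genericPoint F := by
    have := IsHomogeneous.aeval_smul_point hF c⁻¹ C.genericPoint
    rwa [pow_one] at this
  have hψℓ : ψ (ℓ 2) = 1 := by
    ext
    rw [hψc _ (hℓ 2), ← hc, inv_mul_cancel₀ hc0]
    rfl
  have hψI : ∀ F ∈ C.ideal, ψ F = 0 := by
    intro F hF
    rw [← sum_homogeneousComponent F, map_sum]
    refine Finset.sum_eq_zero fun d _ => ?_
    ext
    have := IsHomogeneous.aeval_smul_point (homogeneousComponent_isHomogeneous d F) c⁻¹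
      C.genericPoint
    rw [(C.aeval_genericPoint_eq_zero_iff _).mpr
      (homogeneousComponent_mem_of_mem C.isHomogeneous hF d), mul_zero] at this
    exact this
  have hdim := ringKrullDim_le_topologicalKrullDim_zeroLocus C.ideal C.isHomogeneous ψ hψs hψI
    (hℓ 2) hψℓ
  rw [C.dim_eq_one] at hdim
  have : Algebra.FiniteType K (aeval (R := K) y).range := Algebra.FiniteType.of_surjective ψ hψs
  have hdep : ¬ AlgebraicIndependent K (![ψ (ℓ 0), ψ (ℓ 1)]) := by
    intro h
    have := h.le_ringKrullDim.trans hdim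
    norm_cast at this
  rw [algebraicIndependent_iff] at hdep
  push Not at hdep
  obtain ⟨P, hP, hP0⟩ := hdep
  set Q : MvPolynomial (Fin 3) K := rename Fin.castSucc P with hQ
  refine ⟨Q.totalDegree, homogenizeAlong (X 2) Q, ?_,
    isHomogeneous_homogenizeAlong (isHomogeneous_X _ _) _, ?_⟩
  · intro h
    -- Setting the last variable to one recovers `P`, so the homogenized relation is nonzero.
    have h1 := map_homogenizeAlong (aeval (![X 0, X 1, 1] : Fin 3 → MvPolynomial (Fin 2) K))
      (ℓ := X 2) (by simp) Q
    rw [h, map_zero, hQ, aeval_rename] at h1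
    apply hP0
    rw [h1]
    conv_lhs => rw [← aeval_X_left_apply P]
    congr 2
    ext i : 1
    fin_cases i <;> simp
  · rw [← aeval_genericPoint_eq_zero_iff, aeval_genericPoint_aeval]
    have h2 := IsHomogeneous.aeval_smul_point
      (isHomogeneous_homogenizeAlong (isHomogeneous_X K (2 : Fin 3)) Q) c
      (fun i => (ψ (ℓ i) : C.ConeField))
    have h3 := map_homogenizeAlong (aeval (R := K) (fun i => (ψ (ℓ i) : C.ConeField)))
      (ℓ := X 2) (by simp [hψℓ]) Q
    have h4 : aeval (fun i => (ψ (ℓ i) : C.ConeField)) Q = 0 := by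
      rw [hQ, aeval_rename]
      have := congrArg (Subalgebra.val _) hP
      rw [map_zero, ← AlgHom.comp_apply, comp_aeval] at this
      rw [← this]
      congr 2
      ext i : 1
      fin_cases i <;> rfl
    rw [h3, h4, mul_zero] at h2
    rw [← h2]
    congr 2
    ext i : 1
    simp [hψc _ (hℓ i), hc0]

variable {C}

theorem X_notMem_ideal (hC : C.Nondegenerate) (i : Fin (n + 1)) : X i ∉ C.ideal :=
  hC _ (isHomogeneous_X K i) (X_ne_zero i)

theorem homogeneousComponent_aeval_X_mem {i j : Fin (n + 1)} {G : MvPolynomial (Fin 2) K}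
    (hG : aeval ![(X i : MvPolynomial (Fin (n + 1)) K), X j] G ∈ C.ideal) (d : ℕ) :
    aeval ![(X i : MvPolynomial (Fin (n + 1)) K), X j] (homogeneousComponent d G) ∈ C.ideal := by
  have := homogeneousComponent_mem_of_mem C.isHomogeneous hG d
  have hr (P : MvPolynomial (Fin 2) K) :
      aeval ![(X i : MvPolynomial (Fin (n + 1)) K), X j] P = rename ![i, j] P := by
    rw [rename_eq_aeval]
    congr 2
    ext k : 1
    fin_cases k <;> rfl
  rw [hr] at this ⊢
  rwa [← rename_homogeneousComponent] at this

/-- A nontrivial homogeneous relation between `x_i` and `x_j` would make `x_i / x_j` algebraic over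
`K`, hence a constant `a`, and the hyperplane `x_i = a x_j` would contain the curve. -/
theorem eq_zero_of_aeval_X_mem [IsAlgClosed K] (hC : C.Nondegenerate) {i j : Fin (n + 1)}
    (hij : i ≠ j) {G : MvPolynomial (Fin 2) K}
    (hG : aeval ![(X i : MvPolynomial (Fin (n + 1)) K), X j] G ∈ C.ideal) : G = 0 := by
  suffices h : ∀ d, homogeneousComponent d G = 0 by
    rw [← sum_homogeneousComponent G]
    exact Finset.sum_eq_zero fun d _ => h d
  intro d
  replace hG := homogeneousComponent_aeval_X_mem hG d
  set P := homogeneousComponent d G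
  have hPh : P.IsHomogeneous d := homogeneousComponent_isHomogeneous d G
  rw [← aeval_genericPoint_eq_zero_iff, aeval_genericPoint_aeval] at hG
  have hxj : C.genericPoint j ≠ 0 := by
    intro h
    apply X_notMem_ideal hC j
    rw [← aeval_genericPoint_eq_zero_iff, aeval_X, h]
  set u := C.genericPoint i / C.genericPoint j with hu
  set p : Polynomial K := aeval ![(Polynomial.X : Polynomial K), 1] P with hp
  have hpu : Polynomial.aeval u p = 0 := by
    have h1 := IsHomogeneous.aeval_smul_point hPh (C.genericPoint j) ![u, 1]
    have h2 : (fun k => aeval C.genericPoint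
        (![(X i : MvPolynomial (Fin (n + 1)) K), X j] k)) = C.genericPoint j • ![u, 1] := by
      ext k
      fin_cases k
      · simp [hu, mul_div_cancel₀ _ hxj]
      · simp
    rw [← h2, hG] at h1
    have h3 := (mul_eq_zero.mp h1.symm).resolve_left (pow_ne_zero _ hxj)
    rw [hp, ← AlgHom.comp_apply, comp_aeval, ← h3]
    congr 2
    ext k : 1
    fin_cases k <;> simp
  have hp0 : p = 0 := by
    by_contra hp0
    have halg : IsAlgebraic K u := ⟨p, hp0, hpu⟩
    obtain ⟨a, ha⟩ := minpoly.mem_range_of_degree_eq_one K u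
      (IsAlgClosed.degree_eq_one_of_irreducible K (minpoly.irreducible halg.isIntegral))
    rw [hu, eq_div_iff hxj] at ha
    refine hC (X i - MvPolynomial.C a * X j)
      ((isHomogeneous_X K i).sub (isHomogeneous_C_mul_X a j)) ?_ ?_
    · intro h
      have := congrArg (eval (Pi.single i 1)) h
      simp [Pi.single_eq_of_ne hij.symm] at this
    · change _ ∈ C.ideal
      rw [← aeval_genericPoint_eq_zero_iff]
      simp [← ha, algHom_C]
  -- The dehomogenization `p` controls `P` only where the second coordinate is nonzero; the factor
  -- `X 1` covers the remaining points.
  have hzero : X 1 * P = 0 := by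
    refine MvPolynomial.funext fun a => ?_
    rw [map_mul, eval_X, map_zero]
    by_cases ha : a 1 = 0
    · rw [ha, zero_mul]
    · have h1 := IsHomogeneous.eval_smul_point hPh (a 1) ![a 0 / a 1, 1]
      have h2 : a 1 • ![a 0 / a 1, 1] = a := by
        ext k
        fin_cases k
        · simp [mul_div_cancel₀ _ ha]
        · simp
      have h3 : eval ![a 0 / a 1, 1] P = Polynomial.aeval (a 0 / a 1) p := by
        rw [hp, ← AlgHom.comp_apply, comp_aeval, ← aeval_eq_eval]
        congr 2
        ext k : 1
        fin_cases k <;> simp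
      rw [h2, h3, hp0, map_zero, mul_zero] at h1
      rw [h1, mul_zero]
  exact (mul_eq_zero.mp hzero).resolve_left (X_ne_zero _)

/-! ### The ambient dimension is at least three -/

theorem two_le_ringKrullDim_coordRing [IsAlgClosed K] (hC : C.Nondegenerate) (hn : 1 ≤ n) :
    2 ≤ ringKrullDim C.CoordRing := by
  have : AlgebraicIndependent K ![Ideal.Quotient.mk C.ideal (X ⟨0, by omega⟩),
      Ideal.Quotient.mk C.ideal (X ⟨1, by omega⟩)] := by
    rw [algebraicIndependent_iff]
    intro G hG
    refine eq_zero_of_aeval_X_mem hC (i := ⟨0, by omega⟩) (j := ⟨1, by omega⟩) (by simp) ?_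
    rw [← Ideal.Quotient.eq_zero_iff_mem, ← hG, ← Ideal.Quotient.mkₐ_eq_mk K, ← AlgHom.comp_apply,
      comp_aeval]
    congr 2
    ext k : 1
    fin_cases k <;> rfl
  exact this.le_ringKrullDim

/-- A polynomial vanishing on a nondegenerate curve has degree at least two. -/
theorem two_le_totalDegree (hC : C.Nondegenerate) {F : MvPolynomial (Fin (n + 1)) K}
    (hF : F ∈ C.ideal) (hF0 : F ≠ 0) : 2 ≤ F.totalDegree := by
  by_contra hlt
  have h1 : homogeneousComponent 1 F = 0 := by
    by_contra h
    exact hC _ (homogeneousComponent_isHomogeneous 1 F) h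
      (homogeneousComponent_mem_of_mem C.isHomogeneous hF 1)
  have h0 : homogeneousComponent 0 F = 0 := by
    by_contra h
    have hmem := homogeneousComponent_mem_of_mem C.isHomogeneous hF 0
    rw [homogeneousComponent_zero] at h hmem
    have hc : coeff 0 F ≠ 0 := fun h' => h (by rw [h', map_zero])
    exact C.isPrime.ne_top (Ideal.eq_top_of_isUnit_mem _ hmem (hc.isUnit.map MvPolynomial.C))
  apply hF0
  rw [← sum_homogeneousComponent F]
  refine Finset.sum_eq_zero fun d hd => ?_
  have : d < 2 := by
    have := Finset.mem_range.mp hd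
    omega
  interval_cases d
  · exact h0
  · exact h1

/-- The ideal contains a prime element `f`, of degree at least two. If `f` generated the ideal, both
quadrics would be scalar multiples of `f`, so `0 ⊂ (f) ⊂ I` is a strict chain of primes. -/
theorem two_le_height (hC : C.Nondegenerate) {g₁ g₂ : MvPolynomial (Fin (n + 1)) K}
    (hg₁ : g₁.IsHomogeneous 2) (hg₂ : g₂.IsHomogeneous 2)
    (hlin : LinearIndependent K ![g₁, g₂]) (hCg₁ : g₁ ∈ C.ideal) (hCg₂ : g₂ ∈ C.ideal) :
    2 ≤ C.ideal.height := by
  have hg₁0 : g₁ ≠ 0 := hlin.ne_zero 0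
  have hg₂0 : g₂ ≠ 0 := hlin.ne_zero 1
  obtain ⟨f, hf, hfp⟩ := C.isPrime.exists_mem_prime_of_ne_bot
    (fun h => hg₁0 (by rw [h] at hCg₁; simpa using hCg₁))
  have hdeg := two_le_totalDegree hC hf hfp.ne_zero
  have hmul {g : MvPolynomial (Fin (n + 1)) K} (hg : g.IsHomogeneous 2) (hg0 : g ≠ 0)
      (hfg : f ∣ g) : ∃ c : K, c ≠ 0 ∧ g = c • f := by
    obtain ⟨q, rfl⟩ := hfg
    have hq0 : q ≠ 0 := right_ne_zero_of_mul hg0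
    have := hg.totalDegree hg0
    rw [totalDegree_mul_of_isDomain hfp.ne_zero hq0] at this
    have hq := totalDegree_eq_zero_iff_eq_C.mp (show q.totalDegree = 0 by omega)
    refine ⟨coeff 0 q, fun h => hq0 (by rw [hq, h, map_zero]), ?_⟩
    rw [smul_eq_C_mul, mul_comm, ← hq]
  have : (Ideal.span {f}).IsPrime := (Ideal.span_singleton_prime hfp.ne_zero).mpr hfp
  have hlt : Ideal.span {f} < C.ideal := by
    refine lt_of_le_of_ne (by simpa [Ideal.span_le] using hf) fun h => ?_
    obtain ⟨a, ha, h₁⟩ := hmul hg₁ hg₁0 (by rwa [← Ideal.mem_span_singleton, h])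
    obtain ⟨b, hb, h₂⟩ := hmul hg₂ hg₂0 (by rwa [← Ideal.mem_span_singleton, h])
    have := LinearIndependent.pair_iff.mp hlin b (-a) (by
      rw [h₁, h₂, smul_smul, smul_smul, ← add_smul]
      simp [mul_comm])
    exact hb this.1
  have hbot : (⊥ : Ideal (MvPolynomial (Fin (n + 1)) K)) < Ideal.span {f} := by
    rw [bot_lt_iff_ne_bot, Ne, Ideal.span_singleton_eq_bot]
    exact hfp.ne_zero
  have h1 := Ideal.height_add_one_le_of_lt_of_isPrime hlt
  have h2 := Ideal.height_add_one_le_of_lt_of_isPrime hbot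
  rw [Ideal.height_bot, zero_add] at h2
  calc (2 : ℕ∞) = 1 + 1 := by norm_num
    _ ≤ _ := (add_le_add_left h2 1).trans h1

theorem three_le_of_mem_quadrics [IsAlgClosed K] (hC : C.Nondegenerate)
    {g₁ g₂ : MvPolynomial (Fin (n + 1)) K} (hg₁ : g₁.IsHomogeneous 2) (hg₂ : g₂.IsHomogeneous 2)
    (hlin : LinearIndependent K ![g₁, g₂]) (hCg₁ : g₁ ∈ C.ideal) (hCg₂ : g₂ ∈ C.ideal) :
    3 ≤ n := by
  have hht := two_le_height hC hg₁ hg₂ hlin hCg₁ hCg₂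
  have hdimS : ringKrullDim (MvPolynomial (Fin (n + 1)) K) = (n + 1 : ℕ) := by
    rw [MvPolynomial.ringKrullDim_of_isNoetherianRing]
    simp
  have hle : (C.ideal.height : WithBot ℕ∞) ≤ (n + 1 : ℕ) :=
    hdimS ▸ Ideal.height_le_ringKrullDim_of_isPrime
  have h1 : 1 ≤ n := by
    have : ((2 : ℕ∞) : WithBot ℕ∞) ≤ (n + 1 : ℕ) := le_trans (by exact_mod_cast hht) hle
    have : 2 ≤ n + 1 := by exact_mod_cast this
    omega
  -- Three nested primes of the coordinate ring pull back to primes of heights at least 2, 3 and 4.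
  obtain ⟨q, hq⟩ := (Order.le_krullDim_iff (n := 2)).mp (two_le_ringKrullDim_coordRing hC h1)
  let P (i : Fin (q.length + 1)) : Ideal (MvPolynomial (Fin (n + 1)) K) :=
    (q i).asIdeal.comap (Ideal.Quotient.mk C.ideal)
  have hP (i) : (P i).IsPrime := (q i).isPrime.comap _
  have hlt {i j : Fin (q.length + 1)} (hij : i < j) : (P i).height + 1 ≤ (P j).height :=
    Ideal.height_add_one_le_of_lt_of_isPrime
      ((Ideal.orderEmbeddingOfSurjective (Ideal.Quotient.mk C.ideal)
        Ideal.Quotient.mk_surjective).strictMono (q.strictMono hij))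
  have h0 : (2 : ℕ∞) ≤ (P ⟨0, by omega⟩).height := by
    refine hht.trans (Ideal.height_mono fun F hF => ?_)
    rw [Ideal.mem_comap, Ideal.Quotient.eq_zero_iff_mem.mpr hF]
    exact zero_mem _
  have h01 := hlt (i := ⟨0, by omega⟩) (j := ⟨1, by omega⟩) (Fin.mk_lt_mk.mpr one_pos)
  have h12 := hlt (i := ⟨1, by omega⟩) (j := ⟨2, by omega⟩) (Fin.mk_lt_mk.mpr one_lt_two)
  have h4 : (4 : ℕ∞) ≤ (P ⟨2, by omega⟩).height :=
    calc (4 : ℕ∞) = 2 + 1 + 1 := by norm_num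
      _ ≤ _ := (add_le_add_left ((add_le_add_left h0 1).trans h01) 1).trans h12
  have h5 : ((P ⟨2, by omega⟩).height : WithBot ℕ∞) ≤ (n + 1 : ℕ) :=
    hdimS ▸ Ideal.height_le_ringKrullDim_of_isPrime
  have h6 : ((4 : ℕ∞) : WithBot ℕ∞) ≤ (n + 1 : ℕ) := le_trans (by exact_mod_cast h4) h5
  have : 4 ≤ n + 1 := by exact_mod_cast h6
  omega

end IrreducibleCurve

/-! ### Derivations -/

section Derivations

open TensorProduct

/-- In characteristic zero `L` is separable over `K(x)`, hence formally étale over `K[x]`. The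
differentials of `L` are then the base change of those of `K[x]`, which are free on the `dx_i`. -/
theorem IsTranscendenceBasis.exists_derivation {K L ι : Type*} [Field K] [Field L] [Algebra K L]
    [CharZero K] {x : ι → L} (hx : IsTranscendenceBasis K x) (c : ι → L) :
    ∃ D : Derivation K L L, ∀ i, D (x i) = c i := by
  let : Algebra (MvPolynomial ι K) L := (aeval x).toRingHom.toAlgebra
  have hmap (p : MvPolynomial ι K) : algebraMap (MvPolynomial ι K) L p = aeval x p := rfl
  have : IsScalarTower K (MvPolynomial ι K) L :=
    IsScalarTower.of_algebraMap_eq fun a => by simp [hmap]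
  have hinj : Function.Injective (algebraMap (MvPolynomial ι K) L) := hx.1
  have : FaithfulSMul (MvPolynomial ι K) L :=
    (faithfulSMul_iff_algebraMap_injective (MvPolynomial ι K) L).mpr hinj
  have halg : Algebra.IsAlgebraic (MvPolynomial ι K) L := by
    have := hx.isAlgebraic
    exact Algebra.IsAlgebraic.of_ringHom_of_comp_eq (S := Algebra.adjoin K (Set.range x)) (B := L)
      hx.1.aevalEquiv.toRingEquiv (RingHom.id L) hx.1.aevalEquiv.surjective
      Function.injective_id (by
        ext p <;> simp [hmap])
  let : Algebra (FractionRing (MvPolynomial ι K)) L :=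
    FractionRing.liftAlgebra (MvPolynomial ι K) L
  have : Algebra.IsAlgebraic (FractionRing (MvPolynomial ι K)) L :=
    (IsFractionRing.comap_isAlgebraic_iff (A := MvPolynomial ι K)).mp halg
  have : CharZero (FractionRing (MvPolynomial ι K)) := charZero_of_injective_algebraMap
    (algebraMap K (FractionRing (MvPolynomial ι K))).injective
  have : Algebra.FormallyEtale (FractionRing (MvPolynomial ι K)) L :=
    Algebra.FormallyEtale.of_isSeparable _ _
  have : Algebra.FormallyEtale (MvPolynomial ι K) (FractionRing (MvPolynomial ι K)) :=
    Algebra.FormallyEtale.of_isLocalization (nonZeroDivisors (MvPolynomial ι K))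
  have : Algebra.FormallyEtale (MvPolynomial ι K) L :=
    Algebra.FormallyEtale.comp (MvPolynomial ι K) (FractionRing (MvPolynomial ι K)) L
  let b := KaehlerDifferential.mvPolynomialBasis K ι
  let f : L ⊗[MvPolynomial ι K] Ω[MvPolynomial ι K⁄K] →ₗ[L] L :=
    LinearMap.liftBaseChange L (b.constr (MvPolynomial ι K) c)
  let e := KaehlerDifferential.tensorKaehlerEquivOfFormallyEtale K (MvPolynomial ι K) L
  refine ⟨(f ∘ₗ e.symm.toLinearMap).compDer (KaehlerDifferential.D K L), fun i => ?_⟩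
  have h1 : x i = algebraMap (MvPolynomial ι K) L (X i) := by simp [hmap]
  have h2 : KaehlerDifferential.D K (MvPolynomial ι K) (X i) = b i :=
    (KaehlerDifferential.mvPolynomialBasis_apply K ι i).symm
  change f (e.symm (KaehlerDifferential.D K L (x i))) = c i
  rw [h1, KaehlerDifferential.tensorKaehlerEquivOfFormallyEtale_symm_D_algebraMap, h2,
    LinearMap.liftBaseChange_tmul, one_smul, Module.Basis.constr_basis]

theorem Derivation.apply_aeval_eq_sum {K A σ : Type*} [Field K] [CommRing A] [Algebra K A]
    [Fintype σ] (D : Derivation K A A) (x : σ → A) (F : MvPolynomial σ K) :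
    D (aeval x F) = ∑ i, D (x i) * aeval x (pderiv i F) := by
  classical
  induction F using MvPolynomial.induction_on with
  | C a => simp [algHom_C]
  | add p q hp hq => simp [hp, hq, mul_add, Finset.sum_add_distrib]
  | mul_X p j hp =>
    simp only [map_mul, aeval_X, Derivation.leibniz, hp, smul_eq_mul, map_add, pderiv_X, mul_add,
      Finset.sum_add_distrib]
    congr 1
    · simp [Pi.single_apply, apply_ite, mul_comm]
    · rw [Finset.mul_sum]
      exact Finset.sum_congr rfl fun i _ => by ring

end Derivations

/-! ### Transcendence bases of the field of the cone -/

namespace IrreducibleCurve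

variable {K : Type*} [Field K] {n : ℕ} {C : IrreducibleCurve K n}

theorem algebraicIndependent_genericPoint [IsAlgClosed K] (hC : C.Nondegenerate)
    {i j : Fin (n + 1)} (hij : i ≠ j) :
    AlgebraicIndependent K ![C.genericPoint i, C.genericPoint j] := by
  rw [algebraicIndependent_iff]
  intro G hG
  refine eq_zero_of_aeval_X_mem hC hij ?_
  rw [← aeval_genericPoint_eq_zero_iff, aeval_genericPoint_aeval, ← hG]
  congr 2
  ext k : 1
  fin_cases k <;> simp

theorem isTranscendenceBasis_genericPoint [IsAlgClosed K] (hC : C.Nondegenerate)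
    {i j : Fin (n + 1)} (hij : i ≠ j) :
    IsTranscendenceBasis K ![C.genericPoint i, C.genericPoint j] := by
  have hind := algebraicIndependent_genericPoint hC hij
  rw [hind.isTranscendenceBasis_iff_isAlgebraic]
  set R := Algebra.adjoin K (Set.range ![C.genericPoint i, C.genericPoint j]) with hR
  have hx (k : Fin (n + 1)) : IsAlgebraic R (C.genericPoint k) := by
    by_contra htr
    have h1 := (hind.option_iff_transcendental (C.genericPoint k)).mpr htr
    obtain ⟨d, G, hG0, -, hG⟩ := C.exists_homogeneous_relation
      ![X i, X j, X k] (by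
        intro m
        fin_cases m <;> exact isHomogeneous_X K _) (X_notMem_ideal hC k)
    have h2 := h1.comp (![some 0, some 1, none] : Fin 3 → Option (Fin 2)) (by decide)
    rw [algebraicIndependent_iff] at h2
    refine hG0 (h2 G ?_)
    rw [← aeval_genericPoint_eq_zero_iff, aeval_genericPoint_aeval] at hG
    rw [← hG]
    congr 2
    ext m : 1
    fin_cases m <;> simp
  have hS (F : MvPolynomial (Fin (n + 1)) K) : IsAlgebraic R (aeval C.genericPoint F) := by
    have h : aeval C.genericPoint F ∈ Algebra.adjoin K (Set.range C.genericPoint) := by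
      rw [Algebra.adjoin_range_eq_range_aeval]
      exact ⟨F, rfl⟩
    have hle : Algebra.adjoin K (Set.range C.genericPoint) ≤
        (Subalgebra.algebraicClosure R C.ConeField).restrictScalars K := by
      rw [Algebra.adjoin_le_iff]
      rintro _ ⟨k, rfl⟩
      exact hx k
    exact hle h
  refine ⟨fun z => ?_⟩
  obtain ⟨a, b, -, rfl⟩ := IsFractionRing.div_surjective (A := C.CoordRing) z
  obtain ⟨F, rfl⟩ := Ideal.Quotient.mk_surjective a
  obtain ⟨G, rfl⟩ := Ideal.Quotient.mk_surjective b
  rw [← aeval_genericPoint, ← aeval_genericPoint, div_eq_mul_inv]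
  exact (hS F).mul (hS G).inv

end IrreducibleCurve

/-! ### Generic smoothness -/

theorem MvPolynomial.notMem_vars_of_pderiv_eq_zero {K σ : Type*} [Field K] [CharZero K]
    {F : MvPolynomial σ K} {i : σ} (hF : pderiv i F = 0) : i ∉ F.vars := by
  classical
  rw [mem_vars_iff_mem_support]
  rintro ⟨m, hm, hi⟩
  have hle : Finsupp.single i 1 ≤ m := by
    rw [Finsupp.single_le_iff]
    exact Nat.one_le_iff_ne_zero.mpr (Finsupp.mem_support_iff.mp hi)
  have h := coeff_pderiv (i := i) F (m - Finsupp.single i 1)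
  rw [hF, coeff_zero, tsub_add_cancel_of_le hle] at h
  rcases mul_eq_zero.mp h.symm with h | h
  · exact mem_support_iff.mp hm h
  · exact Nat.cast_add_one_ne_zero _ h

namespace IrreducibleCurve

variable {K : Type*} [Field K] {n : ℕ} {C : IrreducibleCurve K n}

/-- On a nondegenerate curve, each coordinate is separably algebraic over two others. -/
theorem exists_mem_ideal_pderiv_notMem [IsAlgClosed K] [CharZero K] (hC : C.Nondegenerate)
    {i j k : Fin (n + 1)} (hij : i ≠ j) (hki : k ≠ i) (hkj : k ≠ j) :
    ∃ (d : ℕ) (F : MvPolynomial (Fin (n + 1)) K), F.IsHomogeneous d ∧ F ∈ C.ideal ∧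
      pderiv k F ∉ C.ideal ∧ ∀ m, m ≠ i → m ≠ j → m ≠ k → pderiv m F = 0 := by
  classical
  have he : Function.Injective ![i, j, k] := by
    intro a b hab
    fin_cases a <;> fin_cases b <;> simp_all
  have hren (G : MvPolynomial (Fin 3) K) : aeval ![(X i : MvPolynomial (Fin (n + 1)) K), X j, X k] G
      = rename ![i, j, k] G := by
    rw [rename_eq_aeval]
    congr 2
    ext m : 1
    fin_cases m <;> rfl
  have hex : ∃ (d : ℕ) (G : MvPolynomial (Fin 3) K), G ≠ 0 ∧ G.IsHomogeneous d ∧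
      rename ![i, j, k] G ∈ C.ideal := by
    obtain ⟨d, G, hG0, hGd, hG⟩ := C.exists_homogeneous_relation
      ![X i, X j, X k] (by
        intro m
        fin_cases m <;> exact isHomogeneous_X K _) (X_notMem_ideal hC k)
    exact ⟨d, G, hG0, hGd, hren G ▸ hG⟩
  -- A relation of least degree: its derivative in the last variable has smaller degree, so it
  -- cannot be a relation unless it is zero. If it is zero, `G` involves only `x_i` and `x_j`, which
  -- are independent.
  obtain ⟨G, hG0, hGd, hG⟩ := Nat.find_spec hex
  set d := Nat.find hex with hd
  refine ⟨d, rename ![i, j, k] G, hGd.rename_isHomogeneous, hG, ?_, ?_⟩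
  · have hk : pderiv k (rename ![i, j, k] G) = rename ![i, j, k] (pderiv 2 G) :=
      pderiv_rename he 2 G
    rw [hk]
    intro hmem
    have hder : pderiv 2 G = 0 := by
      by_contra hne
      have hd0 : d ≠ 0 := by
        intro hd0
        rw [hd0] at hGd
        rw [totalDegree_eq_zero_iff_eq_C.mp (Nat.le_zero.mp hGd.totalDegree_le),
          pderiv_C] at hne
        exact hne rfl
      exact Nat.find_min hex (show d - 1 < Nat.find hex by omega) ⟨_, hne, hGd.pderiv, hmem⟩
    have hvars := notMem_vars_of_pderiv_eq_zero hder
    obtain ⟨G', hG'⟩ := exists_rename_eq_of_vars_subset_range G (Fin.castSucc : Fin 2 → Fin 3)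
      (Fin.castSucc_injective 2) (by
        intro m hm
        fin_cases m
        · exact ⟨0, rfl⟩
        · exact ⟨1, rfl⟩
        · exact (hvars hm).elim)
    apply hG0
    rw [← hG', rename_rename] at hG
    rw [← hG', eq_zero_of_aeval_X_mem hC hij (G := G') ?_, map_zero]
    rw [rename_eq_aeval] at hG
    convert hG using 3
    ext m : 1
    fin_cases m <;> rfl
  · intro m hmi hmj hmk
    apply pderiv_eq_zero_of_notMem_vars
    intro hm
    obtain ⟨a, -, rfl⟩ := mem_vars_rename _ _ hm
    fin_cases a <;> simp_all

/-- Where `h` does not vanish, projection to the coordinates `i` and `j` is an isomorphism from the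
tangent space to `K × K`. The equations `F k` determine the other coordinates, which gives
injectivity; derivations of the cone field specialize to tangent vectors, which gives surjectivity.
-/
theorem exists_forall_finrank_tangentSpace [IsAlgClosed K] [CharZero K] (hC : C.Nondegenerate)
    (hn : 1 ≤ n) : ∃ (d : ℕ) (h : MvPolynomial (Fin (n + 1)) K), h.IsHomogeneous d ∧
      h ∉ C.ideal ∧ ∀ P ∈ C.points, eval P.rep h ≠ 0 →
        Module.finrank K (C.tangentSpace P) = 2 := by
  classical
  let i : Fin (n + 1) := ⟨0, by omega⟩
  let j : Fin (n + 1) := ⟨1, by omega⟩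
  have hij : i ≠ j := by simp [i, j]
  have hex (k : Fin (n + 1)) : ∃ (d : ℕ) (F : MvPolynomial (Fin (n + 1)) K), k ≠ i → k ≠ j →
      F.IsHomogeneous d ∧ F ∈ C.ideal ∧ pderiv k F ∉ C.ideal ∧
      ∀ m, m ≠ i → m ≠ j → m ≠ k → pderiv m F = 0 := by
    by_cases hk : k ≠ i ∧ k ≠ j
    · obtain ⟨d, F, hF⟩ := exists_mem_ideal_pderiv_notMem hC hij hk.1 hk.2
      exact ⟨d, F, fun _ _ => hF⟩
    · exact ⟨0, 0, fun h1 h2 => (hk ⟨h1, h2⟩).elim⟩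
  choose d F hF using hex
  let s : Finset (Fin (n + 1)) := Finset.univ.filter fun k => k ≠ i ∧ k ≠ j
  have hs {k : Fin (n + 1)} : k ∈ s ↔ k ≠ i ∧ k ≠ j := by simp [s]
  let h : MvPolynomial (Fin (n + 1)) K := ∏ k ∈ s, pderiv k (F k)
  refine ⟨∑ k ∈ s, (d k - 1), h, IsHomogeneous.prod _ _ _ fun k hk => ?_, ?_, ?_⟩
  · exact (hF k (hs.mp hk).1 (hs.mp hk).2).1.pderiv
  · intro hmem
    obtain ⟨k, hk, hk'⟩ := (C.isPrime.prod_mem_iff).mp hmem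
    exact (hF k (hs.mp hk).1 (hs.mp hk).2).2.2.1 hk'
  · intro P hP hP0
    have hFP {k : Fin (n + 1)} (hk : k ∈ s) : eval P.rep (pderiv k (F k)) ≠ 0 := by
      rw [map_prod] at hP0
      exact Finset.prod_ne_zero_iff.mp hP0 k hk
    let f : C.tangentSpace P →ₗ[K] K × K :=
      { toFun := fun w => (w.1 i, w.1 j)
        map_add' := fun _ _ => rfl
        map_smul' := fun _ _ => rfl }
    have hsum {A : Type _} [AddCommMonoid A] (a : Fin (n + 1) → A) {k : Fin (n + 1)} (hk : k ∈ s)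
        (ha : ∀ m, m ≠ i → m ≠ j → m ≠ k → a m = 0) : ∑ m, a m = a i + a j + a k := by
      rw [← Finset.sum_subset (Finset.subset_univ {i, j, k})]
      · rw [Finset.sum_insert, Finset.sum_pair, add_assoc]
        · exact (hs.mp hk).2.symm
        · simp [hij, (hs.mp hk).1.symm]
      · intro m _ hm
        simp only [Finset.mem_insert, Finset.mem_singleton, not_or] at hm
        exact ha m hm.1 hm.2.1 hm.2.2
    have hinj : Function.Injective f := by
      rw [← LinearMap.ker_eq_bot, LinearMap.ker_eq_bot']
      rintro ⟨w, hw⟩ hfw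
      have hwi : w i = 0 := congrArg Prod.fst hfw
      have hwj : w j = 0 := congrArg Prod.snd hfw
      ext k
      change w k = 0
      by_cases hk : k ∈ s
      · obtain ⟨-, hFk, -, hFm⟩ := hF k (hs.mp hk).1 (hs.mp hk).2
        have := hw (F k) hFk
        rw [hsum _ hk (fun m h1 h2 h3 => by rw [hFm m h1 h2 h3, map_zero, mul_zero]), hwi, hwj,
          zero_mul, zero_mul, zero_add, zero_add] at this
        exact (mul_eq_zero.mp this).resolve_right (hFP hk)
      · rw [hs] at hk
        by_cases hki : k = i
        · rw [hki, hwi]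
        · rw [not_not.mp fun hkj => hk ⟨hki, hkj⟩, hwj]
    have hsurj : Function.Surjective f := by
      rintro ⟨a, b⟩
      obtain ⟨D, hD⟩ := (isTranscendenceBasis_genericPoint hC hij).exists_derivation
        ![algebraMap K _ a, algebraMap K _ b]
      have hDi : D (C.genericPoint i) = algebraMap K _ a := hD 0
      have hDj : D (C.genericPoint j) = algebraMap K _ b := hD 1
      -- The polynomial `W m` represents `h * D (x_m)`, the denominators having been cleared by
      -- means of `F m`. The tangent vector sought is the value of `W / h` at `P`.
      let W (m : Fin (n + 1)) : MvPolynomial (Fin (n + 1)) K :=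
        if m = i then MvPolynomial.C a * h else if m = j then MvPolynomial.C b * h else
          -(MvPolynomial.C a * pderiv i (F m) + MvPolynomial.C b * pderiv j (F m)) *
            ∏ k ∈ s.erase m, pderiv k (F k)
      have hW (m : Fin (n + 1)) : aeval C.genericPoint (W m) =
          aeval C.genericPoint h * D (C.genericPoint m) := by
        by_cases hmi : m = i
        · simp only [W, if_pos hmi]
          rw [hmi, hDi, map_mul, algHom_C, mul_comm]
        by_cases hmj : m = j
        · simp only [W, if_neg hmi, if_pos hmj]
          rw [hmj, hDj, map_mul, algHom_C, mul_comm]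
        have hm : m ∈ s := hs.mpr ⟨hmi, hmj⟩
        obtain ⟨-, hFk, -, hFm⟩ := hF m hmi hmj
        have h1 := D.apply_aeval_eq_sum C.genericPoint (F m)
        rw [(C.aeval_genericPoint_eq_zero_iff _).mpr hFk, map_zero,
          hsum _ hm (fun m h1 h2 h3 => by rw [hFm m h1 h2 h3, map_zero, mul_zero]), hDi, hDj] at h1
        have h2 : h = pderiv m (F m) * ∏ k ∈ s.erase m, pderiv k (F k) :=
          (Finset.mul_prod_erase s (fun k => pderiv k (F k)) hm).symm
        simp only [W, if_neg hmi, if_neg hmj]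
        rw [h2]
        simp only [map_mul, map_neg, map_add, algHom_C]
        linear_combination (aeval C.genericPoint (∏ k ∈ s.erase m, pderiv k (F k))) * h1
      have hWI (G : MvPolynomial (Fin (n + 1)) K) (hG : G ∈ C.ideal) :
          ∑ m, W m * pderiv m G ∈ C.ideal := by
        rw [← aeval_genericPoint_eq_zero_iff]
        have h1 := D.apply_aeval_eq_sum C.genericPoint G
        rw [(C.aeval_genericPoint_eq_zero_iff _).mpr hG, map_zero] at h1
        simp only [map_sum, map_mul, hW, mul_assoc]
        rw [← Finset.mul_sum, ← h1, mul_zero]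
      refine ⟨⟨fun m => (eval P.rep h)⁻¹ * eval P.rep (W m), fun G hG => ?_⟩, ?_⟩
      · have h1 : eval P.rep (∑ m, W m * pderiv m G) = 0 := hP _ (hWI G hG)
        simp only [map_sum, map_mul] at h1
        simp only [mul_assoc]
        rw [← Finset.mul_sum, h1, mul_zero]
      · have hi : W i = MvPolynomial.C a * h := if_pos rfl
        have hj : W j = MvPolynomial.C b * h := by simp [W, hij.symm]
        ext
        · change (eval P.rep h)⁻¹ * eval P.rep (W i) = a
          rw [hi, map_mul, eval_C]
          field_simp
        · change (eval P.rep h)⁻¹ * eval P.rep (W j) = b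
          rw [hj, map_mul, eval_C]
          field_simp
    rw [(LinearEquiv.ofBijective f ⟨hinj, hsurj⟩).finrank_eq]
    simp

end IrreducibleCurve

/-! ### Differentials of forms -/

section Polar

variable {K σ : Type*} [Field K]

theorem MvPolynomial.IsHomogeneous.eval_linear {F : MvPolynomial σ K} (hF : F.IsHomogeneous 1)
    (p v : σ → K) (s t : K) :
    MvPolynomial.eval (s • p + t • v) F =
      s * MvPolynomial.eval p F + t * MvPolynomial.eval v F := by
  rw [← mem_homogeneousSubmodule, homogeneousSubmodule_one_eq_span_X] at hF
  induction hF using Submodule.span_induction with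
  | mem x hx =>
    obtain ⟨i, rfl⟩ := hx
    simp
  | zero => simp
  | add x y _ _ hx hy => simp only [map_add, hx, hy]; ring
  | smul a x _ hx => simp only [smul_eval, hx]; ring

variable [Fintype σ]

/-- The differential of a polynomial at a point, as a linear form. -/
noncomputable def differentialForm (p : σ → K) (F : MvPolynomial σ K) : MvPolynomial σ K :=
  ∑ i, MvPolynomial.C (eval p (pderiv i F)) * X i

theorem isHomogeneous_differentialForm (p : σ → K) (F : MvPolynomial σ K) :
    (differentialForm p F).IsHomogeneous 1 :=
  IsHomogeneous.sum _ _ _ fun i _ => isHomogeneous_C_mul_X _ i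

theorem eval_differentialForm (p v : σ → K) (F : MvPolynomial σ K) :
    eval v (differentialForm p F) = ∑ i, v i * eval p (pderiv i F) := by
  simp [differentialForm, mul_comm]

theorem eval_single_differentialForm [DecidableEq σ] (p : σ → K) (F : MvPolynomial σ K) (i : σ) :
    eval (Pi.single i 1) (differentialForm p F) = eval p (pderiv i F) := by
  simp [eval_differentialForm, Pi.single_apply]

theorem differentialForm_add (p : σ → K) (F G : MvPolynomial σ K) :
    differentialForm p (F + G) = differentialForm p F + differentialForm p G := by
  simp [differentialForm, add_mul, Finset.sum_add_distrib]

theorem differentialForm_mul (p : σ → K) (F G : MvPolynomial σ K) :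
    differentialForm p (F * G) = MvPolynomial.C (eval p F) * differentialForm p G +
      MvPolynomial.C (eval p G) * differentialForm p F := by
  simp only [differentialForm, pderiv_mul, Finset.mul_sum, ← Finset.sum_add_distrib]
  refine Finset.sum_congr rfl fun i _ => ?_
  simp only [map_add, map_mul]
  ring

theorem differentialForm_smul (p : σ → K) (c : K) (F : MvPolynomial σ K) :
    differentialForm p (c • F) = c • differentialForm p F := by
  simp [differentialForm, Finset.smul_sum, smul_eq_C_mul, mul_assoc]

theorem differentialForm_eq_self {F : MvPolynomial σ K} (hF : F.IsHomogeneous 1) (p : σ → K) :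
    differentialForm p F = F := by
  classical
  rw [← mem_homogeneousSubmodule, homogeneousSubmodule_one_eq_span_X] at hF
  induction hF using Submodule.span_induction with
  | mem x hx =>
    obtain ⟨i, rfl⟩ := hx
    simp [differentialForm, pderiv_X, Pi.single_apply, apply_ite]
  | zero => simp [differentialForm]
  | add x y _ _ hx hy => rw [differentialForm_add, hx, hy]
  | smul a x _ hx => rw [differentialForm_smul, hx]

/-- Products of two linear forms span the quadratic forms, and for such a product the cross term is
the Leibniz rule. -/
theorem MvPolynomial.IsHomogeneous.eval_quadratic {F : MvPolynomial σ K} (hF : F.IsHomogeneous 2)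
    (p v : σ → K) (s t : K) :
    MvPolynomial.eval (s • p + t • v) F = s ^ 2 * MvPolynomial.eval p F +
      s * t * MvPolynomial.eval v (differentialForm p F) + t ^ 2 * MvPolynomial.eval v F := by
  rw [← mem_homogeneousSubmodule, ← homogeneousSubmodule_one_pow, pow_two] at hF
  induction hF using Submodule.mul_induction_on' with
  | mem_mul_mem a ha b hb =>
    rw [mem_homogeneousSubmodule] at ha hb
    rw [differentialForm_mul, differentialForm_eq_self ha, differentialForm_eq_self hb]
    simp only [map_mul, map_add, eval_C]
    rw [IsHomogeneous.eval_linear ha, IsHomogeneous.eval_linear hb]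
    ring
  | add a _ b _ ha hb =>
    rw [differentialForm_add]
    simp only [map_add, ha, hb]
    ring

theorem eval_self_differentialForm {F : MvPolynomial σ K} {d : ℕ} (hF : F.IsHomogeneous d)
    (p : σ → K) : eval p (differentialForm p F) = d * eval p F := by
  have h := congrArg (eval p) hF.sum_X_mul_pderiv
  rw [eval_differentialForm]
  simpa using h

end Polar

/-- The linear form in the coordinates `i` and `k` which vanishes at `p`. -/
noncomputable def vanishingForm {K σ : Type*} [Field K] (p : σ → K) (i k : σ) : MvPolynomial σ K :=
  MvPolynomial.C (p i) * X k - MvPolynomial.C (p k) * X i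

namespace IrreducibleCurve

variable {K : Type*} [Field K] {n : ℕ} {C : IrreducibleCurve K n}

/-! ### Points of a curve -/

theorem eval_smul_eq_zero {p : Fin (n + 1) → K} (hp : ∀ F ∈ C.ideal, eval p F = 0) (c : K) :
    ∀ F ∈ C.ideal, eval (c • p) F = 0 := by
  intro F hF
  rw [← sum_homogeneousComponent F, map_sum]
  refine Finset.sum_eq_zero fun d _ => ?_
  rw [IsHomogeneous.eval_smul_point (homogeneousComponent_isHomogeneous d F),
    hp _ (homogeneousComponent_mem_of_mem C.isHomogeneous hF d), mul_zero]

theorem exists_mem_points_eval_ne_zero [IsAlgClosed K] (hC : C.Nondegenerate)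
    {h : MvPolynomial (Fin (n + 1)) K} {d : ℕ} (hd : h.IsHomogeneous d) (hh : h ∉ C.ideal) :
    ∃ P ∈ C.points, eval P.rep h ≠ 0 := by
  -- The factor `X 0` keeps the zero supplied by the Nullstellensatz away from the origin, so that
  -- it defines a projective point.
  have hX : X 0 * h ∉ C.ideal := fun hm =>
    (C.isPrime.mem_or_mem hm).elim (X_notMem_ideal hC 0) hh
  rw [← MvPolynomial.IsPrime.vanishingIdeal_zeroLocus (K := K) C.ideal,
    mem_vanishingIdeal_iff] at hX
  push Not at hX
  obtain ⟨a, ha, ha0⟩ := hX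
  rw [map_mul, aeval_X] at ha0
  have hane : a ≠ 0 := by
    rintro rfl
    simp at ha0
  obtain ⟨c, hc⟩ := Projectivization.exists_smul_eq_mk_rep K a hane
  refine ⟨Projectivization.mk K a hane, fun F hF => ?_, ?_⟩
  · change eval _ F = 0
    rw [← hc]
    exact eval_smul_eq_zero (C := C) (fun G hG => by simpa [aeval_eq_eval] using ha G hG)
      (c : K) F hF
  · rw [← hc, Units.smul_def, IsHomogeneous.eval_smul_point hd]
    refine mul_ne_zero (pow_ne_zero _ c.ne_zero) ?_
    simpa [aeval_eq_eval] using right_ne_zero_of_mul ha0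

theorem mem_tangentSpace_iff {P : ProjSpace K n} {w : Fin (n + 1) → K} :
    w ∈ C.tangentSpace P ↔ ∀ F ∈ C.ideal, eval w (differentialForm P.rep F) = 0 := by
  simp only [eval_differentialForm]
  rfl

/-- Euler's relation, applied to each homogeneous component. -/
theorem rep_mem_tangentSpace {P : ProjSpace K n} (hP : P ∈ C.points) :
    P.rep ∈ C.tangentSpace P := by
  rw [mem_tangentSpace_iff]
  intro F hF
  have hsum : differentialForm P.rep F = ∑ d ∈ Finset.range (F.totalDegree + 1),
      differentialForm P.rep (homogeneousComponent d F) := by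
    conv_lhs => rw [← sum_homogeneousComponent F]
    exact map_sum (AddMonoidHom.mk' _ (differentialForm_add P.rep)) _ _
  rw [hsum, map_sum]
  refine Finset.sum_eq_zero fun d _ => ?_
  rw [eval_self_differentialForm (homogeneousComponent_isHomogeneous d F)]
  have : eval P.rep (homogeneousComponent d F) = 0 :=
    hP _ (homogeneousComponent_mem_of_mem C.isHomogeneous hF d)
  rw [this, mul_zero]

/-! ### Genericity conditions on a line through a point -/

/-- The cone over a curve with vertex `p` is contained in a hypersurface. -/
theorem exists_cone_equation (hC : C.Nondegenerate) (hn : 3 ≤ n) {p : Fin (n + 1) → K}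
    (hp : p ≠ 0) : ∃ Q : MvPolynomial (Fin (n + 1)) K, Q ≠ 0 ∧
      ∀ q v : Fin (n + 1) → K, (∀ F ∈ C.ideal, eval q F = 0) →
        ∀ s t : K, t ≠ 0 → q = s • p + t • v → eval v Q = 0 := by
  classical
  obtain ⟨i, hi⟩ := Function.ne_iff.mp hp
  replace hi : p i ≠ 0 := hi
  obtain ⟨e, he⟩ : ∃ e : Fin 3 ↪ Fin (n + 1), ∀ m, e m ≠ i := by
    have hcard : Fintype.card (Fin 3) ≤ Fintype.card {k : Fin (n + 1) // k ≠ i} := by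
      rw [Fintype.card_subtype_compl]
      simp
      omega
    obtain ⟨e⟩ := Function.Embedding.nonempty_of_card_le hcard
    exact ⟨e.trans (Function.Embedding.subtype _), fun m => (e m).2⟩
  -- Three linear forms vanishing at `p`, so unchanged under translation by multiples of `p`. Any
  -- relation between them on `C` is the equation of a cone with vertex `p`.
  set ℓ : Fin 3 → MvPolynomial (Fin (n + 1)) K := fun m => vanishingForm p i (e m) with hℓdef
  have hℓ (m) : (ℓ m).IsHomogeneous 1 :=
    (isHomogeneous_C_mul_X _ _).sub (isHomogeneous_C_mul_X _ _)
  have hℓp (m) : eval p (ℓ m) = 0 := by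
    simp [ℓ, vanishingForm, mul_comm]
  -- A left inverse of the substitution of `ℓ`: it shows that `G` remains nonzero after the
  -- substitution.
  let σ : MvPolynomial (Fin (n + 1)) K →ₐ[K] MvPolynomial (Fin 3) K :=
    aeval fun k => if h : ∃ m, e m = k then MvPolynomial.C (p i)⁻¹ * X h.choose else 0
  have hσ (m) : σ (ℓ m) = X m := by
    have h1 : ∃ m', e m' = e m := ⟨m, rfl⟩
    have h2 : h1.choose = m := e.injective h1.choose_spec
    have h3 : ¬ ∃ m', e m' = i := fun ⟨m', hm'⟩ => he m' hm'
    simp only [ℓ, vanishingForm, σ, map_sub, map_mul, aeval_X, algHom_C, dif_pos h1, dif_neg h3, h2]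
    rw [mul_zero, sub_zero, ← mul_assoc, MvPolynomial.algebraMap_eq, ← map_mul,
      mul_inv_cancel₀ hi, map_one, one_mul]
  have hℓ0 : ℓ 2 ≠ 0 := fun h => by
    have := hσ 2
    rw [h, map_zero] at this
    exact X_ne_zero _ this.symm
  obtain ⟨d, G, hG0, -, hG⟩ := C.exists_homogeneous_relation ℓ hℓ (hC _ (hℓ 2) hℓ0)
  refine ⟨aeval ℓ G, fun h => hG0 ?_, fun q v hq s t ht hqv => ?_⟩
  · have h1 := congrArg σ h
    rw [map_zero, ← AlgHom.comp_apply, comp_aeval] at h1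
    simpa only [hσ, aeval_X_left_apply] using h1
  · have hev (u : Fin (n + 1) → K) : eval u (aeval ℓ G) = eval (fun m => eval u (ℓ m)) G := by
      have := DFunLike.congr_fun (comp_aeval ℓ (aeval (R := K) u)) G
      simpa [aeval_eq_eval] using this
    have h1 (m) : eval v (ℓ m) = eval (t⁻¹ • q) (ℓ m) := by
      rw [hqv, IsHomogeneous.eval_smul_point (hℓ m), IsHomogeneous.eval_linear (hℓ m), hℓp]
      field_simp
      ring
    rw [hev]
    simp only [h1]
    rw [← hev]
    exact eval_smul_eq_zero hq _ _ hG

/-- Two quadrics through a nondegenerate curve restrict to linearly independent forms on a general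
line through a point at which the first one is smooth. -/
theorem quadric_determinant_ne_zero (hC : C.Nondegenerate)
    {g₁ g₂ : MvPolynomial (Fin (n + 1)) K} (hg₁ : g₁.IsHomogeneous 2) (hg₂ : g₂.IsHomogeneous 2)
    (hlin : LinearIndependent K ![g₁, g₂]) (hCg₁ : g₁ ∈ C.ideal) {p : Fin (n + 1) → K}
    (hp : differentialForm p g₁ ≠ 0) :
    differentialForm p g₁ * g₂ - differentialForm p g₂ * g₁ ≠ 0 := by
  intro h
  rw [sub_eq_zero] at h
  set b := differentialForm p g₁
  have hg₁0 : g₁ ≠ 0 := hlin.ne_zero 0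
  have hg₂0 : g₂ ≠ 0 := hlin.ne_zero 1
  have hb1 : b.totalDegree = 1 := (isHomogeneous_differentialForm p g₁).totalDegree hp
  have hprime : Prime b := by
    refine (irreducible_of_totalDegree_eq_one hb1 fun x hx => ?_).prime
    rw [isUnit_iff_ne_zero]
    rintro rfl
    exact hp (MvPolynomial.ext _ _ fun m => by simpa using hx m)
  -- If the linear form `b` divides the other differential, then `g₂` is a multiple of `g₁`. If it
  -- divides `g₁`, then `g₁` is a product of two linear forms and one of them contains the curve.
  rcases hprime.dvd_or_dvd (Dvd.intro _ h) with ⟨q, hq⟩ | ⟨m, hm⟩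
  · rw [hq, mul_assoc] at h
    have hgq := mul_left_cancel₀ hp h
    have hq0 : q ≠ 0 := fun h0 => hg₂0 (by rw [hgq, h0, zero_mul])
    have hdeg := congrArg MvPolynomial.totalDegree hgq
    rw [totalDegree_mul_of_isDomain hq0 hg₁0, hg₁.totalDegree hg₁0, hg₂.totalDegree hg₂0] at hdeg
    have hqC := totalDegree_eq_zero_iff_eq_C.mp (show q.totalDegree = 0 by omega)
    have := LinearIndependent.pair_iff.mp hlin (coeff 0 q) (-1) (by
      rw [smul_eq_C_mul, ← hqC, ← hgq]
      simp)
    exact one_ne_zero (neg_eq_zero.mp this.2)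
  · have hm0 : m ≠ 0 := fun h0 => hg₁0 (by rw [hm, h0, mul_zero])
    have hdeg := congrArg MvPolynomial.totalDegree hm
    rw [totalDegree_mul_of_isDomain hp hm0, hg₁.totalDegree hg₁0, hb1] at hdeg
    rw [hm] at hCg₁
    rcases C.isPrime.mem_or_mem hCg₁ with hmem | hmem
    · have := two_le_totalDegree hC hmem hp
      omega
    · have := two_le_totalDegree hC hmem hm0
      omega

end IrreducibleCurve

/-! ### The main theorem -/

theorem eval_rep_eq_zero_iff {K : Type*} [Field K] {n : ℕ} {F : MvPolynomial (Fin (n + 1)) K}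
    {d : ℕ} (hF : F.IsHomogeneous d) {w : Fin (n + 1) → K} (hw : w ≠ 0) :
    eval (Projectivization.mk K w hw).rep F = 0 ↔ eval w F = 0 := by
  obtain ⟨c, hc⟩ := Projectivization.exists_smul_eq_mk_rep K w hw
  rw [← hc, Units.smul_def, IsHomogeneous.eval_smul_point hF, mul_eq_zero]
  simp

theorem mainTheorem4 {K : Type*} [Field K] [IsAlgClosed K] [CharZero K] {n : ℕ}
    (C : IrreducibleCurve K n) (hC : C.Nondegenerate)
    (g₁ g₂ : MvPolynomial (Fin (n + 1)) K)
    (hg₁ : g₁.IsHomogeneous 2) (hg₂ : g₂.IsHomogeneous 2)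
    (hlin : LinearIndependent K ![g₁, g₂])
    (hCg₁ : C.LiesOn g₁) (hCg₂ : C.LiesOn g₂) :
    ∃ L : Projectivization.Subspace K (Fin (n + 1) → K), IsProjLine L ∧
      (∀ a b : K, (a, b) ≠ (0, 0) →
        ¬ (L : Set (ProjSpace K n)) ⊆ projZeros (a • g₁ + b • g₂)) ∧
      ∃ P : ProjSpace K n, (L : Set (ProjSpace K n)) ∩ C.points = {P} ∧
        MeetsTransversallyAt L C P := by
  classical
  have hn : 3 ≤ n := IrreducibleCurve.three_le_of_mem_quadrics hC hg₁ hg₂ hlin hCg₁ hCg₂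
  -- a general point of the curve
  obtain ⟨d, h, hhd, hhC, hh⟩ := IrreducibleCurve.exists_forall_finrank_tangentSpace hC
    (by omega : 1 ≤ n)
  have hg₁0 : g₁ ≠ 0 := hlin.ne_zero 0
  obtain ⟨k, hk⟩ : ∃ k, pderiv k g₁ ≠ 0 := by
    by_contra hall
    push Not at hall
    have := hg₁.sum_X_mul_pderiv
    simp [hall, hg₁0] at this
  -- A partial derivative of `g₁` is a linear form, so by nondegeneracy it does not vanish
  -- identically on `C`.
  obtain ⟨P, hPC, hP⟩ := IrreducibleCurve.exists_mem_points_eval_ne_zero hC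
    (hhd.mul hg₁.pderiv) (fun hm => (C.isPrime.mem_or_mem hm).elim hhC (hC _ hg₁.pderiv hk))
  rw [map_mul] at hP
  have hT := hh P hPC (left_ne_zero_of_mul hP)
  set p := P.rep with hp
  have hp0 : p ≠ 0 := P.rep_nonzero
  have hb : differentialForm p g₁ ≠ 0 := fun h0 => by
    apply right_ne_zero_of_mul hP
    rw [← eval_single_differentialForm, h0, map_zero]
  -- a general direction
  obtain ⟨Q, hQ0, hQ⟩ := IrreducibleCurve.exists_cone_equation hC hn hp0
  have hD := IrreducibleCurve.quadric_determinant_ne_zero hC hg₁ hg₂ hlin hCg₁ hb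
  obtain ⟨F, hFC, hF0⟩ : ∃ F ∈ C.ideal, differentialForm p F ≠ 0 := by
    by_contra hall
    push Not at hall
    have htop : C.tangentSpace P = ⊤ := by
      rw [eq_top_iff]
      intro w _
      rw [IrreducibleCurve.mem_tangentSpace_iff]
      intro F hF
      rw [hall F hF, map_zero]
    rw [htop, finrank_top, Module.finrank_fin_fun] at hT
    omega
  -- The three factors serve in turn `L ∩ C = {P}`, the pencil condition and transversality.
  obtain ⟨v, hv⟩ : ∃ v, eval v (Q * (differentialForm p g₁ * g₂ - differentialForm p g₂ * g₁) *
      differentialForm p F) ≠ 0 := by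
    by_contra hall
    push Not at hall
    exact mul_ne_zero (mul_ne_zero hQ0 hD) hF0 (MvPolynomial.funext fun v => by
      rw [hall v, map_zero])
  rw [map_mul, map_mul] at hv
  have hvQ := left_ne_zero_of_mul (left_ne_zero_of_mul hv)
  have hvD := right_ne_zero_of_mul (left_ne_zero_of_mul hv)
  have hvF := right_ne_zero_of_mul hv
  have hpT : p ∈ C.tangentSpace P := IrreducibleCurve.rep_mem_tangentSpace hPC
  have hvT : v ∉ C.tangentSpace P := fun hm =>
    hvF (IrreducibleCurve.mem_tangentSpace_iff.mp hm F hFC)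
  have hind : LinearIndependent K ![p, v] := by
    rw [LinearIndependent.pair_iff' hp0]
    rintro a rfl
    exact hvT (Submodule.smul_mem _ a hpT)
  -- the line
  set W : Submodule K (Fin (n + 1) → K) := Submodule.span K (Set.range ![p, v]) with hW
  have hmemW (w : Fin (n + 1) → K) : w ∈ W ↔ ∃ s t : K, s • p + t • v = w := by
    rw [hW, Matrix.range_cons, Matrix.range_cons, Matrix.range_empty, Set.union_empty,
      Set.singleton_union, Submodule.mem_span_pair]
  have hpW : p ∈ W := (hmemW p).mpr ⟨1, 0, by simp⟩
  have hvW : v ∈ W := (hmemW v).mpr ⟨0, 1, by simp⟩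
  have hsub : Projectivization.Subspace.submodule W.projectivization = W :=
    OrderIso.apply_symm_apply _ _
  have hmemL (R : ProjSpace K n) : R ∈ W.projectivization ↔ R.rep ∈ W := by
    conv_lhs => rw [← R.mk_rep]
    exact Submodule.mk_mem_projectivization_iff W R.rep_nonzero
  refine ⟨W.projectivization, ?_, ?_, P, ?_, ?_⟩
  · rw [IsProjLine, hsub, hW, finrank_span_eq_card hind, Fintype.card_fin]
  · intro a b hab hsubset
    have hhom : (a • g₁ + b • g₂).IsHomogeneous 2 := by
      rw [smul_eq_C_mul, smul_eq_C_mul]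
      exact (hg₁.C_mul a).add (hg₂.C_mul b)
    have hzero (w : Fin (n + 1) → K) (hw : w ∈ W) (hw0 : w ≠ 0) :
        a * eval w g₁ + b * eval w g₂ = 0 := by
      have h1 := (eval_rep_eq_zero_iff hhom hw0).mp
        (hsubset ((Submodule.mk_mem_projectivization_iff W hw0).mpr hw))
      simpa using h1
    have hv0 : v ≠ 0 := hind.ne_zero 1
    have hpv0 : p + v ≠ 0 := fun h0 => by
      have := LinearIndependent.pair_iff.mp hind 1 1 (by simpa using h0)
      exact one_ne_zero this.1
    -- Vanishing at `v` and at `p + v` gives two linear equations in `a` and `b`, whose determinant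
    -- is, up to sign, the nonzero quantity `hvD`.
    have h1 := hzero v hvW hv0
    have h2 := hzero (p + v) (W.add_mem hpW hvW) hpv0
    have h3 (g : MvPolynomial (Fin (n + 1)) K) (hg : g.IsHomogeneous 2) (hgC : g ∈ C.ideal) :
        eval (p + v) g = eval v (differentialForm p g) + eval v g := by
      have := IsHomogeneous.eval_quadratic hg p v 1 1
      have hpg : eval p g = 0 := hPC g hgC
      simpa [hpg] using this
    rw [h3 g₁ hg₁ hCg₁, h3 g₂ hg₂ hCg₂] at h2
    simp only [map_sub, map_mul] at hvD
    apply hab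
    rw [Prod.mk.injEq]
    constructor
    · refine (mul_eq_zero.mp ?_).resolve_right hvD
      linear_combination (eval v g₂) * h2 - (eval v g₂ + eval v (differentialForm p g₂)) * h1
    · refine (mul_eq_zero.mp ?_).resolve_right hvD
      linear_combination (eval v g₁ + eval v (differentialForm p g₁)) * h1 - (eval v g₁) * h2
  · ext R
    rw [Set.mem_inter_iff, Set.mem_singleton_iff, SetLike.mem_coe, hmemL]
    constructor
    · rintro ⟨hRW, hRC⟩
      obtain ⟨s, t, hst⟩ := (hmemW _).mp hRW
      by_cases ht : t = 0
      · rw [ht, zero_smul, add_zero] at hst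
        rw [← R.mk_rep, ← P.mk_rep, Projectivization.mk_eq_mk_iff']
        exact ⟨s, hst⟩
      · exact (hvQ (hQ R.rep v hRC s t ht hst.symm)).elim
    · rintro rfl
      exact ⟨hpW, hPC⟩
  · refine ⟨(hmemL P).mpr hpW, ⟨hPC, hT⟩, ?_⟩
    rw [hsub, Projectivization.submodule_eq]
    apply le_antisymm
    · rintro w ⟨hwT, hwW⟩
      obtain ⟨s, t, rfl⟩ := (hmemW w).mp hwW
      have ht : t = 0 := by
        by_contra ht
        apply hvT
        have h1 : t • v ∈ C.tangentSpace P := by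
          have := (C.tangentSpace P).sub_mem hwT ((C.tangentSpace P).smul_mem s hpT)
          rwa [add_sub_cancel_left] at this
        exact ((C.tangentSpace P).smul_mem_iff ht).mp h1
      rw [ht, zero_smul, add_zero]
      exact Submodule.smul_mem _ s (Submodule.mem_span_singleton_self _)
    · rw [Submodule.span_singleton_le_iff_mem]
      exact ⟨hpT, hpW⟩
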